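/- Let $d\ge 2$, let $\Omega\subset\mathbb{R}^d$ be a bounded Lipschitz domain, and let $A\subset\Omega$ be a $\Lambda$-Lipschitz domain: a nonempty connected open set that, near each point of its boundary and in a suitable Cartesian coordinate system $(\xi,\eta)\in\mathbb{R}^{d-1}\times\mathbb{R}$, coincides with the epigraph $\{\eta>f(\xi)\}$ of a $\Lambda$-Lipschitz function $f$. For $\delta>0$ put \[ U_\delta=\{x\in A:\ \operatorname{dist}(x,\partial A)<\delta\},\qquad A_\delta=A\setminus\overline{U_\delta}. \] Then there exist constants $C>0$ and $\delta_0>0$ such that for every $0<\delta<\delta_0$ and every real-valued $v\in H^1(\Omega)$, \[ \|v\|_{L^2(U_\delta)}^2\le C\left(\delta^2\|\nabla v\|_{L^2(U_\delta)}^2+\delta\|v\|_{H^1(A_\delta)}^2\right), \] where $\|v\|_{H^1(A_\delta)}^2=\|v\|_{L^2(A_\delta)}^2+\|\nabla v\|_{L^2(A_\delta)}^2$. -/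

import Mathlib

open MeasureTheory Metric
open scoped NNReal ContDiff

/-- A (nonempty, open, connected) set `A ⊆ ℝᵈ` with bounded boundary is a `Λ`-Lipschitz domain if
near each boundary point it coincides, in a suitable Cartesian coordinate system `(ξ, η)` with
`ξ ∈ ℝᵈ⁻¹` and `η ∈ ℝ`, with the (strict) epigraph of a `Λ`-Lipschitz function of `d - 1`
variables. The coordinate system is the isometry `Φ`, centred at the boundary point, and
"near" means in the open cylinder `|ξ| < r`, `|η| < b`. -/
structure IsLipschitzDomain {d : ℕ} (Λ : ℝ≥0) (A : Set (EuclideanSpace ℝ (Fin d))) : Prop where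
  isOpen : IsOpen A
  isConnected : IsConnected A
  isBounded_frontier : Bornology.IsBounded (frontier A)
  exists_chart : ∀ p ∈ frontier A,
    ∃ (Φ : EuclideanSpace ℝ (Fin d) ≃ᵢ WithLp 2 (EuclideanSpace ℝ (Fin (d - 1)) × ℝ))
      (f : EuclideanSpace ℝ (Fin (d - 1)) → ℝ) (r b : ℝ),
      Φ p = 0 ∧ LipschitzWith Λ f ∧ f 0 = 0 ∧ 0 < r ∧ 0 < b ∧
        ∀ x, ‖(Φ x).fst‖ < r → |(Φ x).snd| < b → (x ∈ A ↔ f (Φ x).fst < (Φ x).snd)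

/-- `MemH1 Ω v g`: the function `v` belongs to `H¹(Ω)`, and its weak gradient is `g`.
That is, `v` and `g` are square integrable on `Ω` and `∫_Ω v ∂_w φ = - ∫_Ω (g · w) φ` for every
direction `w` and every smooth `φ` with compact support in `Ω`. -/
structure MemH1 {d : ℕ} (Ω : Set (EuclideanSpace ℝ (Fin d)))
    (v : EuclideanSpace ℝ (Fin d) → ℝ)
    (g : EuclideanSpace ℝ (Fin d) → EuclideanSpace ℝ (Fin d)) : Prop where
  memLp : MemLp v 2 (volume.restrict Ω)
  memLp_grad : MemLp g 2 (volume.restrict Ω)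
  integral_mul_fderiv : ∀ φ : EuclideanSpace ℝ (Fin d) → ℝ,
    ContDiff ℝ ∞ φ → HasCompactSupport φ → tsupport φ ⊆ Ω →
      ∀ w : EuclideanSpace ℝ (Fin d),
        ∫ x in Ω, v x * fderiv ℝ φ x w = - ∫ x in Ω, inner ℝ (g x) w * φ x

/-- The squared norm `‖v‖²_{L²(S)}`. -/
noncomputable def l2NormSq {d : ℕ} {F : Type*} [NormedAddCommGroup F]
    (S : Set (EuclideanSpace ℝ (Fin d))) (v : EuclideanSpace ℝ (Fin d) → F) : ℝ :=
  ∫ x in S, ‖v x‖ ^ 2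

/-- The squared norm `‖v‖²_{H¹(S)} = ‖v‖²_{L²(S)} + ‖∇v‖²_{L²(S)}` of a function `v` with
gradient `g`. -/
noncomputable def h1NormSq {d : ℕ} (S : Set (EuclideanSpace ℝ (Fin d)))
    (v : EuclideanSpace ℝ (Fin d) → ℝ)
    (g : EuclideanSpace ℝ (Fin d) → EuclideanSpace ℝ (Fin d)) : ℝ :=
  l2NormSq S v + l2NormSq S g

/-- The boundary layer `U_δ = {x ∈ A : dist(x, ∂A) < δ}`. -/
def boundaryLayer {d : ℕ} (A : Set (EuclideanSpace ℝ (Fin d))) (δ : ℝ) :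
    Set (EuclideanSpace ℝ (Fin d)) :=
  {x ∈ A | infDist x (frontier A) < δ}

/-- The remaining part `A_δ = A \ closure U_δ`. -/
def innerPart {d : ℕ} (A : Set (EuclideanSpace ℝ (Fin d))) (δ : ℝ) :
    Set (EuclideanSpace ℝ (Fin d)) :=
  A \ closure (boundaryLayer A δ)

/-!
The inequality says that in a boundary layer of width `δ` a function is controlled by its values
deeper in the domain, at the cost of the gradient along the way.

Near a boundary point, `A` lies above the graph of a `Λ`-Lipschitz function; let `e` be the vertical
unit vector of the chart and `h` the height above the graph. Points of the layer have
`0 < h ≤ κ` with `κ = (1 + Λ) δ`, since `h` is `(1 + Λ)`-Lipschitz and vanishes on `∂A`. For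
`t ∈ (T/2, T]`, with `T` a fixed length depending on the chart,
`v(x) = v(x + te) - ∫₀ᵗ ⟨∇v(x + se), e⟩ ds`. Squaring, integrating over `x` in the layer and averaging
over `t` gives the claim: a vertical line spends time at most `κ` in the layer, so by Tonelli each
double integral over `x` and `s` (or `t`) is at most `κ` times a single integral
(`lintegral_lintegral_shift_le`), and in the part of `∫ |∇v|` spent in the layer Cauchy–Schwarz gives a
second factor `κ`. This is `lintegral_enorm_sq_le_of_shift`, applied to charts in
`IsLipschitzDomain.exists_local_estimate`; compactness of `∂A` leaves finitely many charts.

All integrals are over Lebesgue measure on the ambient space, and only translations act on it, so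
no change of variables to chart coordinates is needed. For a function with only a weak gradient the
displayed identity holds for almost every `x`; it is obtained by testing against smooth functions
(`ae_sub_eq_integral_weakGradient`), without mollification. Finally, the complement of the layer in
`A` and the set `A \ closure U_δ` differ by points with `dist(x, ∂A) = δ`, which form a null set
(`volume_infDist_eq_zero`).
-/

/-! ### Level sets of the distance function -/

/-- The level sets `{dist(·, F) = δ}`, `δ > 0`, are Lebesgue null: from a point `x` of the level set,
move towards a nearest point of `F`; this produces, at every small scale `r`, a ball of radius
`r / 4` inside `closedBall x r` that misses the level set, so `x` is not a density point. -/
theorem volume_infDist_eq_zero {E : Type*} [NormedAddCommGroup E] [NormedSpace ℝ E]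
    [FiniteDimensional ℝ E] [MeasurableSpace E] [BorelSpace E] (μ : Measure E) [μ.IsAddHaarMeasure]
    {F : Set E} (hF : IsClosed F) (hne : F.Nonempty) {δ : ℝ} (hδ : 0 < δ) :
    μ {x | infDist x F = δ} = 0 := by
  have hL : MeasurableSet {x | infDist x F = δ} :=
    (isClosed_eq (continuous_infDist_pt F) continuous_const).measurableSet
  refine measure_mono_null (fun x hx ↦ ?_)
    (Besicovitch.ae_tendsto_measure_inter_div_of_measurableSet μ hL)
  simp only [Set.mem_compl_iff, Set.mem_ofPred, Set.indicator_of_mem hx, Pi.one_apply]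
  intro H
  obtain ⟨q, hq, hqd⟩ := hF.exists_infDist_eq_dist hne x
  have hxq : dist x q = δ := by rw [← hqd]; exact hx
  set n := Module.finrank ℝ E
  have key : ∀ᶠ r in nhdsWithin (0 : ℝ) (Set.Ioi 0),
      μ ({x | infDist x F = δ} ∩ closedBall x r) / μ (closedBall x r)
        ≤ 1 - ENNReal.ofReal ((1 / 4) ^ n) := by
    filter_upwards [Ioo_mem_nhdsGT hδ] with r hr
    obtain ⟨hr0, hrδ⟩ := hr
    set y := x + (r / (2 * δ)) • (q - x)
    have hyx : dist y x = r / 2 := by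
      rw [dist_eq_norm]; simp only [y, add_sub_cancel_left, norm_smul]
      rw [← dist_eq_norm, dist_comm, hxq, Real.norm_of_nonneg (by positivity)]
      field_simp
    have hyq : dist y q = δ - r / 2 := by
      have h1 : y - q = (1 - r / (2 * δ)) • (x - q) := by simp only [y]; module
      rw [dist_eq_norm, h1, norm_smul, ← dist_eq_norm x q, hxq, Real.norm_of_nonneg]
      · field_simp
      · rw [sub_nonneg, div_le_one (by positivity)]; linarith
    have hsub : closedBall y (r / 4) ⊆ closedBall x r :=
      closedBall_subset_closedBall' (by rw [hyx]; linarith)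
    have hdis : {x | infDist x F = δ} ∩ closedBall x r
        ⊆ closedBall x r \ closedBall y (r / 4) := by
      rintro z ⟨hz, hzx⟩
      refine ⟨hzx, fun hzy ↦ ?_⟩
      have h1 : infDist z F ≤ dist z q := infDist_le_dist_of_mem hq
      have h2 : dist z q ≤ dist z y + dist y q := dist_triangle _ _ _
      have h3 : dist z y ≤ r / 4 := hzy
      have h4 : infDist z F = δ := hz
      linarith
    have hpos : μ (closedBall x r) ≠ 0 := (measure_closedBall_pos μ x hr0).ne'
    have hfin : μ (closedBall x r) ≠ ⊤ := measure_closedBall_lt_top.ne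
    have hsmall : μ (closedBall y (r / 4)) = ENNReal.ofReal ((1 / 4) ^ n) * μ (closedBall x r) := by
      rw [Measure.addHaar_closedBall μ y (by positivity), Measure.addHaar_closedBall μ x hr0.le,
        ← mul_assoc, ← ENNReal.ofReal_mul (by positivity), ← mul_pow]
      congr 3; ring
    calc _ ≤ μ (closedBall x r \ closedBall y (r / 4)) / μ (closedBall x r) := by gcongr
      _ = 1 - ENNReal.ofReal ((1 / 4) ^ n) := by
        rw [measure_sdiff hsub measurableSet_closedBall.nullMeasurableSet
          measure_closedBall_lt_top.ne, ENNReal.sub_div fun _ _ ↦ hpos, hsmall,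
          ENNReal.div_self hpos hfin, ENNReal.mul_div_cancel_right hpos hfin]
  have h1 := le_of_tendsto H key
  have h2 : (1 : ENNReal) - ENNReal.ofReal ((1 / 4) ^ n) < 1 :=
    ENNReal.sub_lt_self ENNReal.one_ne_top one_ne_zero (by simp)
  exact absurd h1 (not_le.2 h2)

/-! ### Two inequalities for extended nonnegative numbers -/

theorem sq_lintegral_le_measure_mul {α : Type*} [MeasurableSpace α] (μ : Measure α)
    {f : α → ENNReal} (hf : AEMeasurable f μ) :
    (∫⁻ x, f x ∂μ) ^ 2 ≤ μ Set.univ * ∫⁻ x, f x ^ 2 ∂μ := by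
  have h := ENNReal.lintegral_mul_le_Lp_mul_Lq μ Real.HolderConjugate.two_two hf
    (aemeasurable_const (b := (1 : ENNReal)))
  simp only [Pi.mul_apply, mul_one, ENNReal.one_rpow, lintegral_const, one_mul] at h
  calc (∫⁻ x, f x ∂μ) ^ 2 ≤ _ := pow_le_pow_left₀ bot_le h 2
    _ = _ := by
      rw [mul_pow, ← ENNReal.rpow_natCast, ← ENNReal.rpow_natCast, ← ENNReal.rpow_mul,
        ← ENNReal.rpow_mul]
      norm_num
      rw [mul_comm]

theorem ENNReal.add_sq_le_two_mul (a b : ENNReal) : (a + b) ^ 2 ≤ 2 * a ^ 2 + 2 * b ^ 2 := by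
  have h := ENNReal.rpow_add_le_mul_rpow_add_rpow a b (p := 2) (by norm_num)
  norm_num at h
  rwa [mul_add] at h

/-! ### Translation along a direction -/

section Translation

variable {E : Type*} [NormedAddCommGroup E] [InnerProductSpace ℝ E] [FiniteDimensional ℝ E]
  [MeasurableSpace E] [BorelSpace E]

/-- If every line in direction `e` spends at most time `κ` in `S`, then integrating `F` along the
segments issuing from `S` costs only a factor `κ`. -/
theorem lintegral_lintegral_shift_le (e : E) {S : Set E} (hS : MeasurableSet S) {κ : ENNReal}
    (hκ : ∀ y, volume {s : ℝ | y - s • e ∈ S} ≤ κ) (I : Set ℝ) {F : E → ENNReal} (hF : Measurable F) :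
    ∫⁻ x in S, ∫⁻ s in I, F (x + s • e) ≤ κ * ∫⁻ x, F x := by
  have hF1 : Measurable fun p : E × ℝ ↦ F (p.1 + p.2 • e) := hF.comp (by fun_prop)
  rw [lintegral_lintegral_swap hF1.aemeasurable]
  calc ∫⁻ s in I, ∫⁻ x in S, F (x + s • e)
      = ∫⁻ s in I, ∫⁻ y, S.indicator 1 (y - s • e) * F y := by
        refine lintegral_congr fun s ↦ ?_
        rw [← lintegral_indicator hS, ← lintegral_sub_right_eq_self _ (s • e)]
        refine lintegral_congr fun y ↦ ?_
        by_cases h : y - s • e ∈ S <;> simp [h]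
    _ = ∫⁻ y, ∫⁻ s in I, S.indicator 1 (y - s • e) * F y := by
        refine lintegral_lintegral_swap (Measurable.aemeasurable ?_)
        exact ((measurable_one.indicator hS).comp (by fun_prop)).mul (hF.comp measurable_snd)
    _ ≤ ∫⁻ y, κ * F y := by
        refine lintegral_mono fun y ↦ ?_
        have hm : Measurable fun s : ℝ ↦ (S.indicator 1 (y - s • e) : ENNReal) :=
          (measurable_one.indicator hS).comp (by fun_prop)
        rw [lintegral_mul_const _ hm]
        gcongr
        refine le_trans ?_ (hκ y)
        have hT : MeasurableSet {s : ℝ | y - s • e ∈ S} :=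
          (show Measurable fun s : ℝ ↦ y - s • e by fun_prop) hS
        have : (fun s : ℝ ↦ (S.indicator 1 (y - s • e) : ENNReal))
            = {s : ℝ | y - s • e ∈ S}.indicator 1 := by
          ext s; by_cases h : y - s • e ∈ S <;> simp [h]
        rw [this, lintegral_indicator_one hT]
        exact Measure.restrict_apply_le _ _
    _ = κ * ∫⁻ x, F x := lintegral_const_mul _ hF

theorem integrable_shear {F : Type*} [NormedAddCommGroup F] (e : E) {f : E → F}
    (hf : Integrable f) (hfm : StronglyMeasurable f) (ν : Measure ℝ) [IsFiniteMeasure ν] :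
    Integrable (fun p : E × ℝ ↦ f (p.1 + p.2 • e)) (volume.prod ν) := by
  have hm : AEStronglyMeasurable (fun p : E × ℝ ↦ f (p.1 + p.2 • e)) (volume.prod ν) :=
    (hfm.comp_measurable
      (by fun_prop : Measurable fun p : E × ℝ ↦ p.1 + p.2 • e)).aestronglyMeasurable
  rw [integrable_prod_iff' hm]
  refine ⟨.of_forall fun s ↦ hf.comp_add_right (s • e), ?_⟩
  simp only [integral_add_right_eq_self (fun x ↦ ‖f x‖)]
  exact integrable_const _

/-- An integrable function with an integrable weak gradient on `Ω` satisfies the fundamental theorem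
of calculus along almost every segment in a fixed direction. Tested against `φ`, the increment of
`V` becomes an increment of `φ`, which the weak gradient absorbs; Fubini does the rest. -/
theorem ae_sub_eq_integral_weakGradient {Ω O : Set E} (hO : IsOpen O) {V : E → ℝ} {G : E → E}
    (hV : Integrable V) (hG : Integrable G) (hGm : StronglyMeasurable G)
    (hw : ∀ φ : E → ℝ, ContDiff ℝ ∞ φ → HasCompactSupport φ → tsupport φ ⊆ Ω →
      ∀ w : E, ∫ x, V x * fderiv ℝ φ x w = - ∫ x, inner ℝ (G x) w * φ x)
    {e : E} {t : ℝ} (ht : 0 ≤ t) (hOΩ : ∀ x ∈ O, ∀ s ∈ Set.Icc 0 t, x + s • e ∈ Ω) :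
    ∀ᵐ x, x ∈ O → V (x + t • e) - V x = ∫ s in Set.Ioc 0 t, inner ℝ (G (x + s • e)) e := by
  have hGe : Integrable fun x ↦ inner ℝ (G x) e := hG.inner_const e
  have hGem : StronglyMeasurable fun x ↦ inner ℝ (G x) e := hGm.inner stronglyMeasurable_const
  have hsh := integrable_shear e hGe hGem (volume.restrict (Set.Ioc 0 t))
  have hVt : Integrable fun x ↦ V (x + t • e) := hV.comp_add_right _
  have hD : Integrable fun x ↦
      V (x + t • e) - V x - ∫ s in Set.Ioc 0 t, inner ℝ (G (x + s • e)) e :=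
    (hVt.sub hV).sub hsh.integral_prod_left
  have := hO.ae_eq_zero_of_integral_contDiff_smul_eq_zero (μ := volume)
    (hD.locallyIntegrable.locallyIntegrableOn O) ?_
  · filter_upwards [this] with x hx hxO
    exact sub_eq_zero.1 (hx hxO)
  intro φ hφ hφc hφO
  have hφ1 : Continuous φ := hφ.continuous
  have hdφ : Continuous fun x ↦ fderiv ℝ φ x e :=
    (hφ.continuous_fderiv (by simp)).clm_apply continuous_const
  have hdφc : HasCompactSupport fun x ↦ fderiv ℝ φ x e := hφc.fderiv_apply ℝ e
  obtain ⟨M, hM⟩ := hφc.exists_bound_of_continuous hφ1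
  obtain ⟨M', hM'⟩ := hdφc.exists_bound_of_continuous hdφ
  have hbV : ∀ {f : E → ℝ}, Integrable f → Integrable fun x ↦ f x * φ x := fun hf ↦
    hf.mul_bdd hφ1.aestronglyMeasurable (.of_forall hM)
  -- the increment of `V` tested against `φ` is `V` tested against the increment of `φ`
  have h1 : ∫ x, (V (x + t • e) - V x) * φ x = ∫ y, V y * (φ (y - t • e) - φ y) := by
    simp only [sub_mul, mul_sub]
    rw [integral_sub (hbV hVt) (hbV hV), integral_sub _ (hbV hV),
      ← integral_add_right_eq_self (fun y ↦ V y * φ (y - t • e)) (t • e)]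
    · simp
    · exact hV.mul_bdd (hφ1.comp (by fun_prop)).aestronglyMeasurable
        (.of_forall fun _ ↦ hM _)
  have h2 : ∀ y, φ (y - t • e) - φ y = ∫ s in Set.Ioc 0 t, - fderiv ℝ φ (y - s • e) e := by
    intro y
    have hder : ∀ s : ℝ, HasDerivAt (fun s : ℝ ↦ φ (y - s • e)) (- fderiv ℝ φ (y - s • e) e) s := by
      intro s
      have ha : HasDerivAt (fun s : ℝ ↦ y - s • e) (-e) s := by
        simpa using ((hasDerivAt_id s).smul_const e).const_sub y
      have hb := ((hφ.differentiable (by simp)) (y - s • e)).hasFDerivAt.comp_hasDerivAt s ha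
      simpa [Function.comp_def] using hb
    have := intervalIntegral.integral_eq_sub_of_hasDerivAt (a := 0) (b := t)
      (fun s _ ↦ hder s) (Continuous.intervalIntegrable
        (hdφ.comp (by fun_prop : Continuous fun s : ℝ ↦ y - s • e)).neg _ _)
    rw [← intervalIntegral.integral_of_le ht, this]; simp
  have h3 : ∀ s ∈ Set.Ioc 0 t, ∫ y, V y * - fderiv ℝ φ (y - s • e) e
      = ∫ x, inner ℝ (G (x + s • e)) e * φ x := by
    intro s hs
    have := hw (fun y ↦ φ (y - s • e)) (hφ.comp (by fun_prop))
      (hφc.comp_homeomorph (Homeomorph.subRight (s • e))) ?_ e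
    · simp only [fderiv_comp_sub] at this
      simp only [mul_neg, integral_neg, this, neg_neg]
      rw [← integral_add_right_eq_self _ (s • e)]
      simp
    · have hts : tsupport (fun y ↦ φ (y - s • e)) ⊆ (fun y ↦ y - s • e) ⁻¹' tsupport φ :=
        tsupport_comp_subset_preimage φ (by fun_prop)
      intro y hy
      have := hOΩ _ (hφO (hts hy)) s ⟨hs.1.le, hs.2⟩
      simpa using this
  have h4 : Integrable (Function.uncurry fun (y : E) (s : ℝ) ↦ V y * - fderiv ℝ φ (y - s • e) e)
      (volume.prod (volume.restrict (Set.Ioc 0 t))) := by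
    refine (hV.comp_fst (volume.restrict (Set.Ioc 0 t))).mul_bdd (c := M') ?_ (.of_forall fun p ↦ ?_)
    · have := hdφ.comp (by fun_prop : Continuous fun p : E × ℝ ↦ p.1 - p.2 • e)
      exact this.neg.aestronglyMeasurable
    · simpa using hM' (p.1 - p.2 • e)
  have h5 : Integrable (Function.uncurry fun (x : E) (s : ℝ) ↦ inner ℝ (G (x + s • e)) e * φ x)
      (volume.prod (volume.restrict (Set.Ioc 0 t))) := by
    refine hsh.mul_bdd ?_ (.of_forall fun p ↦ hM p.1)
    exact (hφ1.comp continuous_fst).aestronglyMeasurable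
  have h6 : ∫ x, (V (x + t • e) - V x) * φ x
      = ∫ x, (∫ s in Set.Ioc 0 t, inner ℝ (G (x + s • e)) e) * φ x := by
    rw [h1]
    simp only [h2, ← integral_const_mul, ← integral_mul_const]
    rw [integral_integral_swap h4, integral_integral_swap h5]
    exact setIntegral_congr_fun measurableSet_Ioc h3
  simp only [smul_eq_mul, mul_comm (φ _)]
  simp only [sub_mul _ (∫ s in Set.Ioc 0 t, inner ℝ (G (_ + s • e)) e)]
  have hVφ : Integrable fun x ↦ (V (x + t • e) - V x) * φ x := hbV (hVt.sub hV)
  have hGφ : Integrable fun x ↦ (∫ s in Set.Ioc 0 t, inner ℝ (G (x + s • e)) e) * φ x :=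
    hbV hsh.integral_prod_left
  rw [integral_sub hVφ hGφ, h6, sub_self]

/-- The boundary layer inequality for a set `S` that the lines in direction `e` cross in time at
most `κ`, when the segments of length `T` from `S` stay in `U ∪ R` and have left `U` after time `κ`.
Here `|V(x)|² ≤ 2 |V(x + te)|² + 2 (∫₀ᵀ |G(x + se)| ds)²` is averaged over `t ∈ (T/2, T]`, and
Cauchy–Schwarz gains a factor `κ` in the part of the last integral that lies in `U`. -/
theorem lintegral_enorm_sq_le_of_shift {Ω O S U R : Set E} (hO : IsOpen O) (hS : MeasurableSet S)
    (hSO : S ⊆ O) (hU : MeasurableSet U) (hR : MeasurableSet R) {V : E → ℝ} {G : E → E}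
    (hV : Integrable V) (hVm : StronglyMeasurable V)
    (hG : Integrable G) (hGm : StronglyMeasurable G)
    (hw : ∀ φ : E → ℝ, ContDiff ℝ ∞ φ → HasCompactSupport φ → tsupport φ ⊆ Ω →
      ∀ w : E, ∫ x, V x * fderiv ℝ φ x w = - ∫ x, inner ℝ (G x) w * φ x)
    {e : E} (he : ‖e‖ ≤ 1) {T κ : ℝ} (hκ0 : 0 < κ) (hκT : κ ≤ T / 2)
    (hOΩ : ∀ x ∈ O, ∀ s ∈ Set.Icc 0 T, x + s • e ∈ Ω)
    (hκ : ∀ y, volume {s : ℝ | y - s • e ∈ S} ≤ ENNReal.ofReal κ)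
    (hSUR : ∀ x ∈ S, ∀ s ∈ Set.Ioc 0 T, x + s • e ∈ U ∪ R)
    (hSR : ∀ x ∈ S, ∀ s ∈ Set.Ioc κ T, x + s • e ∈ R \ U) :
    ∫⁻ x in S, ‖V x‖ₑ ^ 2 ≤
      ENNReal.ofReal (4 * κ / T) * (∫⁻ x in R, ‖V x‖ₑ ^ 2)
      + ENNReal.ofReal (4 * κ ^ 2) * (∫⁻ x in U, ‖G x‖ₑ ^ 2)
      + ENNReal.ofReal (4 * κ * T) * ∫⁻ x in R, ‖G x‖ₑ ^ 2 := by
  have hT : 0 < T := by linarith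
  have hV2 : Measurable fun x ↦ ‖V x‖ₑ ^ 2 := hVm.enorm.pow_const 2
  have hG2 : Measurable fun x ↦ ‖G x‖ₑ ^ 2 := hGm.enorm.pow_const 2
  set Q : E → ENNReal := fun x ↦ (∫⁻ s in Set.Ioc 0 T, ‖G (x + s • e)‖ₑ) ^ 2
  set IV := ∫⁻ x in S, ‖V x‖ₑ ^ 2
  set RV := ∫⁻ x in R, ‖V x‖ₑ ^ 2 with hRV
  set UG := ∫⁻ x in U, ‖G x‖ₑ ^ 2 with hUG
  set RG := ∫⁻ x in R, ‖G x‖ₑ ^ 2 with hRG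
  have hmeas : ∀ {F : E → ENNReal}, Measurable F → Measurable fun p : E × ℝ ↦ F (p.1 + p.2 • e) :=
    fun hF ↦ hF.comp (by fun_prop)
  have hmeas1 : ∀ {F : E → ENNReal}, Measurable F → ∀ x, Measurable fun s : ℝ ↦ F (x + s • e) :=
    fun hF x ↦ hF.comp (by fun_prop)
  have hQm : Measurable Q := ((hmeas hGm.enorm).lintegral_prod_right').pow_const 2
  -- the fundamental theorem of calculus along the segment of length `t`
  have hpoint : ∀ t ∈ Set.Ioc (T / 2) T,
      IV ≤ 2 * (∫⁻ x in S, ‖V (x + t • e)‖ₑ ^ 2) + 2 * ∫⁻ x in S, Q x := by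
    intro t ht
    have hVt : Measurable fun x ↦ ‖V (x + t • e)‖ₑ ^ 2 := hV2.comp (by fun_prop)
    have hFTC := ae_sub_eq_integral_weakGradient hO hV hG hGm hw (e := e) (t := t)
      (by linarith [ht.1]) (fun x hx s hs ↦ hOΩ x hx s ⟨hs.1, hs.2.trans ht.2⟩)
    rw [← lintegral_const_mul _ hVt, ← lintegral_const_mul _ hQm,
      ← lintegral_add_left (hVt.const_mul 2)]
    refine setLIntegral_mono_ae (by fun_prop) ?_
    filter_upwards [hFTC] with x hx hxS
    have hx1 := hx (hSO hxS)
    have hx2 : V x = V (x + t • e) - ∫ s in Set.Ioc 0 t, inner ℝ (G (x + s • e)) e := by linarith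
    have hx3 : ‖∫ s in Set.Ioc 0 t, inner ℝ (G (x + s • e)) e‖ₑ
        ≤ ∫⁻ s in Set.Ioc 0 T, ‖G (x + s • e)‖ₑ := by
      calc _ ≤ ∫⁻ s in Set.Ioc 0 t, ‖inner ℝ (G (x + s • e)) e‖ₑ :=
          enorm_integral_le_lintegral_enorm _
        _ ≤ ∫⁻ s in Set.Ioc 0 t, ‖G (x + s • e)‖ₑ := by
          refine lintegral_mono fun s ↦ ?_
          rw [enorm_le_iff_norm_le]
          exact (norm_inner_le_norm _ _).trans (mul_le_of_le_one_right (norm_nonneg _) he)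
        _ ≤ _ := lintegral_mono_set (Set.Ioc_subset_Ioc_right ht.2)
    calc ‖V x‖ₑ ^ 2 ≤ (‖V (x + t • e)‖ₑ + ∫⁻ s in Set.Ioc 0 T, ‖G (x + s • e)‖ₑ) ^ 2 := by
          gcongr
          rw [hx2]
          exact enorm_sub_le.trans (by gcongr)
      _ ≤ _ := ENNReal.add_sq_le_two_mul _ _
  -- average over `t ∈ (T / 2, T]`
  have haverage : ENNReal.ofReal (T / 2) * IV
      ≤ 2 * (ENNReal.ofReal κ * RV) + ENNReal.ofReal (T / 2) * (2 * ∫⁻ x in S, Q x) := by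
    have hvol : volume (Set.Ioc (T / 2) T) = ENNReal.ofReal (T / 2) := by
      rw [Real.volume_Ioc]; congr 1; ring
    have hm : Measurable fun t : ℝ ↦ ∫⁻ x in S, ‖V (x + t • e)‖ₑ ^ 2 :=
      (hmeas hV2).lintegral_prod_left'
    calc ENNReal.ofReal (T / 2) * IV = ∫⁻ _ in Set.Ioc (T / 2) T, IV := by
          rw [setLIntegral_const, hvol, mul_comm]
      _ ≤ ∫⁻ t in Set.Ioc (T / 2) T,
            (2 * (∫⁻ x in S, ‖V (x + t • e)‖ₑ ^ 2) + 2 * ∫⁻ x in S, Q x) :=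
          setLIntegral_mono' measurableSet_Ioc hpoint
      _ = 2 * (∫⁻ t in Set.Ioc (T / 2) T, ∫⁻ x in S, ‖V (x + t • e)‖ₑ ^ 2)
            + ENNReal.ofReal (T / 2) * (2 * ∫⁻ x in S, Q x) := by
          rw [lintegral_add_left (hm.const_mul 2), lintegral_const_mul _ hm, setLIntegral_const,
            hvol, mul_comm (ENNReal.ofReal (T / 2))]
      _ ≤ _ := by
          gcongr
          rw [← lintegral_lintegral_swap (f := fun x t ↦ ‖V (x + t • e)‖ₑ ^ 2)
            (hmeas hV2).aemeasurable]
          calc _ ≤ ∫⁻ x in S, ∫⁻ t in Set.Ioc (T / 2) T,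
                (R.indicator fun y ↦ ‖V y‖ₑ ^ 2) (x + t • e) := by
                refine setLIntegral_mono' hS fun x hx ↦ setLIntegral_mono' measurableSet_Ioc
                  fun t ht ↦ ?_
                rw [Set.indicator_of_mem (hSR x hx t ⟨by linarith [ht.1], ht.2⟩).1]
            _ ≤ _ := by
                rw [hRV, ← lintegral_indicator hR]
                exact lintegral_lintegral_shift_le e hS hκ _ (hV2.indicator hR)
  -- split the gradient into its parts in `U` (times up to `κ`) and in `R`
  have hgrad : ∫⁻ x in S, Q x ≤ 2 * (ENNReal.ofReal κ * (ENNReal.ofReal κ * UG))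
      + 2 * (ENNReal.ofReal T * (ENNReal.ofReal κ * RG)) := by
    have hgU : Measurable (U.indicator fun y ↦ ‖G y‖ₑ) := hGm.enorm.indicator hU
    have hgR : Measurable (R.indicator fun y ↦ ‖G y‖ₑ) := hGm.enorm.indicator hR
    have hGU : Measurable (U.indicator fun y ↦ ‖G y‖ₑ ^ 2) := hG2.indicator hU
    have hGR : Measurable (R.indicator fun y ↦ ‖G y‖ₑ ^ 2) := hG2.indicator hR
    have hsq : ∀ (W : Set E) y, (W.indicator (fun y ↦ ‖G y‖ₑ) y) ^ 2
        = W.indicator (fun y ↦ ‖G y‖ₑ ^ 2) y := by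
      intro W y; by_cases h : y ∈ W <;> simp [h]
    have hQle : ∀ x ∈ S, Q x ≤
        2 * (ENNReal.ofReal κ *
            ∫⁻ s in Set.Ioc 0 κ, (U.indicator fun y ↦ ‖G y‖ₑ ^ 2) (x + s • e))
        + 2 * (ENNReal.ofReal T *
            ∫⁻ s in Set.Ioc 0 T, (R.indicator fun y ↦ ‖G y‖ₑ ^ 2) (x + s • e)) := by
      intro x hx
      have h1 : ∫⁻ s in Set.Ioc 0 T, ‖G (x + s • e)‖ₑ
          ≤ (∫⁻ s in Set.Ioc 0 κ, (U.indicator fun y ↦ ‖G y‖ₑ) (x + s • e))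
            + ∫⁻ s in Set.Ioc 0 T, (R.indicator fun y ↦ ‖G y‖ₑ) (x + s • e) := by
        have h2 : ∫⁻ s in Set.Ioc 0 κ, (U.indicator fun y ↦ ‖G y‖ₑ) (x + s • e)
            = ∫⁻ s in Set.Ioc 0 T, (Set.Ioc 0 κ).indicator
              (fun s ↦ (U.indicator fun y ↦ ‖G y‖ₑ) (x + s • e)) s := by
          rw [setLIntegral_indicator measurableSet_Ioc, Set.inter_eq_left.2]
          exact Set.Ioc_subset_Ioc_right (by linarith)
        rw [h2, ← lintegral_add_right _ (hmeas1 hgR x)]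
        refine setLIntegral_mono' measurableSet_Ioc fun s hs ↦ ?_
        by_cases hR' : x + s • e ∈ R
        · rw [Set.indicator_of_mem hR']; exact le_add_self
        · have hs' : s ∈ Set.Ioc 0 κ :=
            ⟨hs.1, not_lt.1 fun h ↦ hR' (hSR x hx s ⟨h, hs.2⟩).1⟩
          rw [Set.indicator_of_mem hs',
            Set.indicator_of_mem ((hSUR x hx s hs).resolve_right hR')]
          exact le_self_add
      have hCS : ∀ (W : Set E), MeasurableSet W → ∀ c : ℝ,
          (∫⁻ s in Set.Ioc 0 c, (W.indicator fun y ↦ ‖G y‖ₑ) (x + s • e)) ^ 2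
            ≤ ENNReal.ofReal c *
              ∫⁻ s in Set.Ioc 0 c, (W.indicator fun y ↦ ‖G y‖ₑ ^ 2) (x + s • e) := by
        intro W hW c
        refine (sq_lintegral_le_measure_mul _
          (hmeas1 (hGm.enorm.indicator hW) x).aemeasurable).trans (le_of_eq ?_)
        simp [hsq]
      calc Q x ≤ _ := pow_le_pow_left₀ bot_le h1 2
        _ ≤ _ := ENNReal.add_sq_le_two_mul _ _
        _ ≤ _ := by gcongr <;> exact hCS _ ‹_› _
    have hmU : Measurable fun x ↦
        ∫⁻ s in Set.Ioc 0 κ, (U.indicator fun y ↦ ‖G y‖ₑ ^ 2) (x + s • e) :=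
      (hmeas hGU).lintegral_prod_right'
    have hmR : Measurable fun x ↦
        ∫⁻ s in Set.Ioc 0 T, (R.indicator fun y ↦ ‖G y‖ₑ ^ 2) (x + s • e) :=
      (hmeas hGR).lintegral_prod_right'
    refine (setLIntegral_mono' hS hQle).trans ?_
    rw [lintegral_add_left ((hmU.const_mul _).const_mul _),
      lintegral_const_mul _ (hmU.const_mul _), lintegral_const_mul _ (hmR.const_mul _),
      lintegral_const_mul _ hmU, lintegral_const_mul _ hmR, hUG, hRG,
      ← lintegral_indicator hU, ← lintegral_indicator hR]
    gcongr
    · exact lintegral_lintegral_shift_le e hS hκ _ hGU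
    · exact lintegral_lintegral_shift_le e hS hκ _ hGR
  have hinv : ENNReal.ofReal (2 / T) * ENNReal.ofReal (T / 2) = 1 := by
    rw [← ENNReal.ofReal_mul (by positivity)]
    rw [show 2 / T * (T / 2) = 1 by field_simp, ENNReal.ofReal_one]
  calc IV = ENNReal.ofReal (2 / T) * (ENNReal.ofReal (T / 2) * IV) := by
        rw [← mul_assoc, hinv, one_mul]
    _ ≤ ENNReal.ofReal (2 / T) * (2 * (ENNReal.ofReal κ * RV)
          + ENNReal.ofReal (T / 2) * (2 * ∫⁻ x in S, Q x)) := by gcongr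
    _ = ENNReal.ofReal (2 / T) * (2 * (ENNReal.ofReal κ * RV)) + 2 * ∫⁻ x in S, Q x := by
        rw [mul_add, ← mul_assoc _ (ENNReal.ofReal (T / 2)), hinv, one_mul]
    _ ≤ ENNReal.ofReal (2 / T) * (2 * (ENNReal.ofReal κ * RV))
          + 2 * (2 * (ENNReal.ofReal κ * (ENNReal.ofReal κ * UG))
            + 2 * (ENNReal.ofReal T * (ENNReal.ofReal κ * RG))) := by gcongr
    _ = _ := by
        have h2 : (2 : ENNReal) = ENNReal.ofReal 2 := by simp
        rw [h2, mul_add, ← add_assoc]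
        simp only [← mul_assoc]
        rw [← ENNReal.ofReal_mul (by positivity), ← ENNReal.ofReal_mul (by positivity),
          ← ENNReal.ofReal_mul (by positivity), ← ENNReal.ofReal_mul (by positivity),
          ← ENNReal.ofReal_mul (by positivity), ← ENNReal.ofReal_mul (by positivity),
          ← ENNReal.ofReal_mul (by positivity)]
        congr 1
        · congr 3 <;> ring
        · congr 2; ring

end Translation

/-! ### The boundary layer and the inner part -/

section BoundaryLayer

variable {d : ℕ} {A : Set (EuclideanSpace ℝ (Fin d))} {δ : ℝ}

theorem isOpen_boundaryLayer (hA : IsOpen A) (δ : ℝ) : IsOpen (boundaryLayer A δ) :=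
  hA.inter (isOpen_lt (continuous_infDist_pt _) continuous_const)

/-- The closure of the layer adds to it, inside `A`, only points of the null set
`{dist(·, ∂A) = δ}`. -/
theorem innerPart_ae_eq_sdiff_boundaryLayer (hδ : 0 < δ) (hne : (frontier A).Nonempty) :
    innerPart A δ =ᵐ[volume] (A \ boundaryLayer A δ : Set (EuclideanSpace ℝ (Fin d))) := by
  have hsub : innerPart A δ ⊆ A \ boundaryLayer A δ := Set.sdiff_subset_sdiff_right subset_closure
  refine hsub.eventuallyLE.antisymm ?_
  refine ae_le_set.2 (measure_mono_null ?_
    (volume_infDist_eq_zero volume isClosed_frontier hne hδ))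
  rintro x ⟨⟨hxA, hxU⟩, hx⟩
  have h1 : x ∈ closure (boundaryLayer A δ) := by
    by_contra h; exact hx ⟨hxA, h⟩
  have h2 : closure (boundaryLayer A δ) ⊆ {x | infDist x (frontier A) ≤ δ} :=
    closure_minimal (fun y hy ↦ hy.2.le) (isClosed_le (continuous_infDist_pt _) continuous_const)
  have h3 : ¬ infDist x (frontier A) < δ := fun h ↦ hxU ⟨hxA, h⟩
  exact le_antisymm (h2 h1) (not_lt.1 h3)

end BoundaryLayer

/-! ### The vertical direction of a chart -/

/-- An isometry onto `F × ℝ` is affine (Mazur–Ulam), so moving along the last axis in the chart is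
moving in a fixed unit direction `e`. -/
theorem IsometryEquiv.exists_unit_vertical {E F : Type*} [NormedAddCommGroup E] [NormedSpace ℝ E]
    [NormedAddCommGroup F] [NormedSpace ℝ F] (Φ : E ≃ᵢ WithLp 2 (F × ℝ)) :
    ∃ e : E, ‖e‖ = 1 ∧ ∀ (x : E) (s : ℝ),
      (Φ (x + s • e)).fst = (Φ x).fst ∧ (Φ (x + s • e)).snd = (Φ x).snd + s := by
  set Ψ := Φ.toRealAffineIsometryEquiv
  set L := Ψ.linearIsometryEquiv
  set u : WithLp 2 (F × ℝ) := WithLp.toLp 2 (0, 1)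
  have hΨ : ∀ x, Φ x = Ψ x := fun x ↦ by simp [Ψ]
  refine ⟨L.symm u, ?_, fun x s ↦ ?_⟩
  · rw [LinearIsometryEquiv.norm_map]
    simp [u]
  · have h : Φ (x + s • L.symm u) = s • u + Φ x := by
      rw [add_comm, ← vadd_eq_add, hΨ, hΨ, Ψ.map_vadd, vadd_eq_add, map_smul]
      congr 2
      exact L.apply_symm_apply u
    rw [h]
    simp [u, add_comm]

/-! ### The estimate near a boundary point -/

/-- The boundary layer inequality near a boundary point `p`. With `h` the height above the graph in
the chart at `p`, `dist(·, ∂A) < δ` forces `h ≤ (1 + Λ) δ`, and translation by `s e` raises `h` by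
exactly `s`; so vertical lines cross the layer in time at most `κ = (1 + Λ) δ`. -/
theorem IsLipschitzDomain.exists_local_estimate {d : ℕ} {Λ : ℝ≥0}
    {Ω A : Set (EuclideanSpace ℝ (Fin d))} (hA : IsLipschitzDomain Λ A) (hAΩ : A ⊆ Ω)
    {p : EuclideanSpace ℝ (Fin d)} (hp : p ∈ frontier A) :
    ∃ ρ > 0, ∃ δ₀ > 0, ∃ C > 0, ∀ δ, 0 < δ → δ < δ₀ →
      ∀ (V : EuclideanSpace ℝ (Fin d) → ℝ)
        (G : EuclideanSpace ℝ (Fin d) → EuclideanSpace ℝ (Fin d)),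
        Integrable V → StronglyMeasurable V → Integrable G → StronglyMeasurable G →
        (∀ φ : EuclideanSpace ℝ (Fin d) → ℝ,
          ContDiff ℝ ∞ φ → HasCompactSupport φ → tsupport φ ⊆ Ω →
          ∀ w, ∫ x, V x * fderiv ℝ φ x w = - ∫ x, inner ℝ (G x) w * φ x) →
        ∫⁻ x in boundaryLayer A δ ∩ ball p ρ, ‖V x‖ₑ ^ 2 ≤
          ENNReal.ofReal C * (ENNReal.ofReal (δ ^ 2) * (∫⁻ x in boundaryLayer A δ, ‖G x‖ₑ ^ 2)
            + ENNReal.ofReal δ * ((∫⁻ x in innerPart A δ, ‖V x‖ₑ ^ 2)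
              + ∫⁻ x in innerPart A δ, ‖G x‖ₑ ^ 2)) := by
  obtain ⟨Φ, f, r, b, hΦp, hf, -, hr, hb, hchart⟩ := hA.exists_chart p hp
  obtain ⟨e, he, hΦe⟩ := Φ.exists_unit_vertical
  set m := min r b with hm
  have hm0 : 0 < m := lt_min hr hb
  set K : ℝ := 1 + Λ with hK
  have hK1 : 1 ≤ K := by simp [hK]
  have hfst : ∀ x y, ‖(Φ x).fst - (Φ y).fst‖ ≤ dist x y := fun x y ↦ by
    rw [← Φ.dist_eq x y, dist_eq_norm]
    exact WithLp.norm_fst_le _ (Φ x - Φ y)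
  have hsnd : ∀ x y, |(Φ x).snd - (Φ y).snd| ≤ dist x y := fun x y ↦ by
    rw [← Φ.dist_eq x y, dist_eq_norm]
    exact WithLp.norm_snd_le _ (Φ x - Φ y)
  have hfst0 : ∀ x, ‖(Φ x).fst‖ ≤ dist x p := fun x ↦ by simpa [hΦp] using hfst x p
  have hsnd0 : ∀ x, |(Φ x).snd| ≤ dist x p := fun x ↦ by simpa [hΦp] using hsnd x p
  -- the height above the graph
  set h : EuclideanSpace ℝ (Fin d) → ℝ := fun x ↦ (Φ x).snd - f (Φ x).fst with hh
  have hhc : Continuous h := by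
    have h1 : Continuous fun x ↦ (Φ x).fst := (WithLp.continuous_fst 2 _ _).comp Φ.continuous
    have h2 : Continuous fun x ↦ (Φ x).snd := (WithLp.continuous_snd 2 _ _).comp Φ.continuous
    exact h2.sub (hf.continuous.comp h1)
  have hhe : ∀ x (s : ℝ), h (x + s • e) = h x + s := fun x s ↦ by
    simp only [hh, hΦe]; ring
  have hchart' : ∀ x, dist x p < m → (x ∈ A ↔ 0 < h x) := fun x hx ↦ by
    rw [hchart x ((hfst0 x).trans_lt (hx.trans_le (min_le_left _ _)))
      ((hsnd0 x).trans_lt (hx.trans_le (min_le_right _ _)))]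
    simp [hh]
  have hfront : ∀ q ∈ frontier A, dist q p < m → h q ≤ 0 := fun q hq hqm ↦ by
    have : q ∉ A := by
      rw [hA.isOpen.frontier_eq] at hq; exact hq.2
    rw [hchart' q hqm] at this
    exact not_lt.1 this
  have hlip : ∀ x y, h x - h y ≤ K * dist x y := fun x y ↦ by
    have h1 := (abs_le.1 (hsnd x y)).2
    have h2 := (abs_le.1 ((Real.dist_eq _ _).symm.trans_le (hf.dist_le_mul (Φ x).fst (Φ y).fst))).1
    rw [dist_eq_norm (Φ x).fst] at h2
    have h3 := mul_le_mul_of_nonneg_left (hfst x y) Λ.2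
    simp only [hh, hK]
    simp only [NNReal.val_eq_coe] at h3
    linarith
  -- a segment of length `T` from `ball p (m / 4)`, fattened by `δ < m / 4`, stays in the cylinder
  set T := m / 2 with hT
  have hdist : ∀ x (s : ℝ), dist x p < m / 4 → s ∈ Set.Icc 0 T → dist (x + s • e) p < 3 * m / 4 :=
    fun x s hx hs ↦ by
      have h1 : dist (x + s • e) x = s := by
        rw [dist_eq_norm]; simp [norm_smul, he, abs_of_nonneg hs.1]
      have := dist_triangle (x + s • e) x p
      have := hs.2
      linarith
  have hKT : 0 < K * T := by positivity
  refine ⟨m / 4, by positivity, m / (4 * K), by positivity, 4 * K / T + 4 * K ^ 2 + 4 * K * T,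
    by positivity, fun δ hδ hδ0 V G hV hVm hG hGm hw ↦ ?_⟩
  have hKδ : K * δ < m / 4 := by
    rw [lt_div_iff₀ (by positivity)] at hδ0 ⊢; linarith
  have hδm : δ < m / 4 := lt_of_le_of_lt (by nlinarith) hKδ
  have hheight : ∀ y, dist y p < 3 * m / 4 → y ∈ boundaryLayer A δ → h y ≤ K * δ := by
    intro y hy hyU
    obtain ⟨q, hq, hqd⟩ := (infDist_lt_iff ⟨p, hp⟩).1 hyU.2
    have h1 : dist q p < m := by
      have := dist_triangle_left q p y
      linarith
    have h2 := hlip y q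
    have h3 := hfront q hq h1
    have h4 := mul_le_mul_of_nonneg_left hqd.le (zero_le_one.trans hK1)
    linarith
  set U := boundaryLayer A δ with hUdef
  have hUo : IsOpen U := isOpen_boundaryLayer hA.isOpen δ
  have hshift : ∀ x ∈ A ∩ ball p (m / 4), ∀ s ∈ Set.Icc 0 T, x + s • e ∈ A := by
    rintro x ⟨hxA, hx⟩ s hs
    have h1 := hdist x s hx hs
    rw [hchart' _ (by linarith), hhe]
    have h2 := (hchart' x (by rw [mem_ball] at hx; linarith)).1 hxA
    linarith [hs.1]
  have hest := lintegral_enorm_sq_le_of_shift (Ω := Ω) (O := A ∩ ball p (m / 4))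
    (S := U ∩ ball p (m / 4)) (U := U) (R := A \ U) (hA.isOpen.inter isOpen_ball)
    (hUo.inter isOpen_ball).measurableSet (Set.inter_subset_inter_left _ fun x hx ↦ hx.1)
    hUo.measurableSet (hA.isOpen.measurableSet.diff hUo.measurableSet) hV hVm hG hGm hw
    he.le (T := T) (κ := K * δ) (by positivity) (by rw [hT]; linarith)
    (fun x hx s hs ↦ hAΩ (hshift x hx s hs)) (fun y ↦ ?_) (fun x hx s hs ↦ ?_)
    (fun x hx s hs ↦ ?_)
  · have hR := innerPart_ae_eq_sdiff_boundaryLayer hδ ⟨p, hp⟩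
    rw [setLIntegral_congr hR, setLIntegral_congr hR]
    refine hest.trans ?_
    set C := 4 * K / T + 4 * K ^ 2 + 4 * K * T with hC
    have c1 : 0 ≤ 4 * K / T := by positivity
    have c2 : 0 ≤ 4 * K ^ 2 := by positivity
    have c3 : 0 ≤ 4 * K * T := by positivity
    have hC0 : 0 ≤ C := by positivity
    have e1 : ENNReal.ofReal (4 * (K * δ) / T) ≤ ENNReal.ofReal C * ENNReal.ofReal δ := by
      rw [← ENNReal.ofReal_mul hC0]
      refine ENNReal.ofReal_le_ofReal ?_
      rw [show 4 * (K * δ) / T = 4 * K / T * δ by ring]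
      gcongr; linarith
    have e2 : ENNReal.ofReal (4 * (K * δ) ^ 2) ≤ ENNReal.ofReal C * ENNReal.ofReal (δ ^ 2) := by
      rw [← ENNReal.ofReal_mul hC0]
      refine ENNReal.ofReal_le_ofReal ?_
      rw [show 4 * (K * δ) ^ 2 = 4 * K ^ 2 * δ ^ 2 by ring]
      gcongr; linarith
    have e3 : ENNReal.ofReal (4 * (K * δ) * T) ≤ ENNReal.ofReal C * ENNReal.ofReal δ := by
      rw [← ENNReal.ofReal_mul hC0]
      refine ENNReal.ofReal_le_ofReal ?_
      rw [show 4 * (K * δ) * T = 4 * K * T * δ by ring]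
      gcongr; linarith
    calc _ ≤ ENNReal.ofReal C * ENNReal.ofReal δ * (∫⁻ x in A \ U, ‖V x‖ₑ ^ 2)
          + ENNReal.ofReal C * ENNReal.ofReal (δ ^ 2) * (∫⁻ x in U, ‖G x‖ₑ ^ 2)
          + ENNReal.ofReal C * ENNReal.ofReal δ * (∫⁻ x in A \ U, ‖G x‖ₑ ^ 2) := by gcongr
      _ = _ := by ring
  · -- the height `h` maps the line through `y` isometrically, and `h ∈ [0, K δ]` on `S`
    have hsub : {s : ℝ | y - s • e ∈ U ∩ ball p (m / 4)} ⊆ Set.Icc (h y - K * δ) (h y) := by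
      rintro s ⟨hsU, hs⟩
      rw [mem_ball] at hs
      have h1 : h (y - s • e) = h y - s := by
        have := hhe y (-s)
        rwa [neg_smul, ← sub_eq_add_neg, ← sub_eq_add_neg] at this
      have h2 := (hchart' (y - s • e) (by linarith)).1 hsU.1
      have h3 := hheight (y - s • e) (by linarith) hsU
      rw [h1] at h2 h3
      exact ⟨by linarith, by linarith⟩
    refine (measure_mono hsub).trans ?_
    rw [Real.volume_Icc, sub_sub_cancel]
  · have := hshift x ⟨hx.1.1, hx.2⟩ s ⟨hs.1.le, hs.2⟩
    by_cases hxU : x + s • e ∈ U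
    exacts [Or.inl hxU, Or.inr ⟨this, hxU⟩]
  · have hs0 : 0 < s := lt_trans (by positivity) hs.1
    have hmem : x + s • e ∉ U := fun hxU ↦ by
      have h1 := hheight _ (hdist x s hx.2 ⟨hs0.le, hs.2⟩) hxU
      have h2 := (hchart' x (by have := hx.2; rw [mem_ball] at this; linarith)).1 hx.1.1
      rw [hhe] at h1
      linarith [hs.1]
    exact ⟨⟨hshift x ⟨hx.1.1, hx.2⟩ s ⟨hs0.le, hs.2⟩, hmem⟩, hmem⟩

/-! ### Measurable representatives -/

theorem ofReal_l2NormSq_eq_lintegral {d : ℕ} {F : Type*} [NormedAddCommGroup F]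
    {Ω S : Set (EuclideanSpace ℝ (Fin d))} (hS : S ⊆ Ω) {v V : EuclideanSpace ℝ (Fin d) → F}
    (hv : MemLp v 2 (volume.restrict Ω)) (hvV : v =ᵐ[volume.restrict Ω] V) :
    ENNReal.ofReal (l2NormSq S v) = ∫⁻ x in S, ‖V x‖ₑ ^ 2 := by
  have hle : volume.restrict S ≤ volume.restrict Ω := Measure.restrict_mono hS le_rfl
  have hi : Integrable (fun x ↦ ‖v x‖ ^ 2) (volume.restrict S) :=
    ((hv.mono_measure hle).norm).integrable_sq
  rw [l2NormSq, ofReal_integral_eq_lintegral_ofReal hi (.of_forall fun x ↦ by positivity)]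
  refine lintegral_congr_ae ?_
  filter_upwards [ae_mono hle hvV] with x hx
  rw [ENNReal.ofReal_pow (norm_nonneg _), ofReal_norm, hx]

/-- A pair `(v, g)` as in `MemH1` can be modified off `Ω` and on a null set so that it becomes
measurable and integrable on the whole space, with the weak gradient identity kept. -/
theorem MemH1.exists_stronglyMeasurable {d : ℕ} {Ω : Set (EuclideanSpace ℝ (Fin d))}
    (hΩ : MeasurableSet Ω) (hΩb : Bornology.IsBounded Ω) {v : EuclideanSpace ℝ (Fin d) → ℝ}
    {g : EuclideanSpace ℝ (Fin d) → EuclideanSpace ℝ (Fin d)} (h : MemH1 Ω v g) :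
    ∃ (V : EuclideanSpace ℝ (Fin d) → ℝ) (G : EuclideanSpace ℝ (Fin d) → EuclideanSpace ℝ (Fin d)),
      Integrable V ∧ StronglyMeasurable V ∧ Integrable G ∧ StronglyMeasurable G ∧
      v =ᵐ[volume.restrict Ω] V ∧ g =ᵐ[volume.restrict Ω] G ∧
      ∀ φ : EuclideanSpace ℝ (Fin d) → ℝ,
        ContDiff ℝ ∞ φ → HasCompactSupport φ → tsupport φ ⊆ Ω →
        ∀ w, ∫ x, V x * fderiv ℝ φ x w = - ∫ x, inner ℝ (G x) w * φ x := by
  have : IsFiniteMeasure (volume.restrict Ω) := ⟨by simpa using hΩb.measure_lt_top⟩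
  have hv := h.memLp.1
  have hg := h.memLp_grad.1
  have hvV : v =ᵐ[volume.restrict Ω] Ω.indicator (hv.mk v) :=
    hv.ae_eq_mk.trans (indicator_ae_eq_restrict hΩ).symm
  have hgG : g =ᵐ[volume.restrict Ω] Ω.indicator (hg.mk g) :=
    hg.ae_eq_mk.trans (indicator_ae_eq_restrict hΩ).symm
  refine ⟨Ω.indicator (hv.mk v), Ω.indicator (hg.mk g), ?_, hv.stronglyMeasurable_mk.indicator hΩ,
    ?_, hg.stronglyMeasurable_mk.indicator hΩ, hvV, hgG, fun φ hφ hφc hφΩ w ↦ ?_⟩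
  · exact (integrable_indicator_iff hΩ).2 ((h.memLp.integrable one_le_two).congr hv.ae_eq_mk)
  · exact (integrable_indicator_iff hΩ).2 ((h.memLp_grad.integrable one_le_two).congr hg.ae_eq_mk)
  · rw [← setIntegral_eq_integral_of_forall_compl_eq_zero (s := Ω),
      ← setIntegral_eq_integral_of_forall_compl_eq_zero (s := Ω)
        (f := fun x ↦ inner ℝ (Ω.indicator (hg.mk g) x) w * φ x)]
    · refine Eq.trans (integral_congr_ae ?_) ((h.integral_mul_fderiv φ hφ hφc hφΩ w).trans
        (congrArg _ (integral_congr_ae ?_)))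
      · filter_upwards [hvV] with x hx using by rw [hx]
      · filter_upwards [hgG] with x hx using by rw [hx]
    · intro x hx; simp [hx]
    · intro x hx; simp [hx]

/-! ### Summation over a finite cover of the boundary -/

theorem theoremB1 {d : ℕ} (hd : 2 ≤ d) (Ω : Set (EuclideanSpace ℝ (Fin d)))
    (hΩ : ∃ Λ₀ : ℝ≥0, IsLipschitzDomain Λ₀ Ω) (hΩb : Bornology.IsBounded Ω)
    (Λ : ℝ≥0) (A : Set (EuclideanSpace ℝ (Fin d))) (hA : IsLipschitzDomain Λ A) (hAΩ : A ⊆ Ω) :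
    ∃ C : ℝ, 0 < C ∧ ∃ δ₀ : ℝ, 0 < δ₀ ∧ ∀ δ : ℝ, 0 < δ → δ < δ₀ →
      ∀ (v : EuclideanSpace ℝ (Fin d) → ℝ)
        (g : EuclideanSpace ℝ (Fin d) → EuclideanSpace ℝ (Fin d)), MemH1 Ω v g →
        l2NormSq (boundaryLayer A δ) v ≤
          C * (δ ^ 2 * l2NormSq (boundaryLayer A δ) g + δ * h1NormSq (innerPart A δ) v g) := by
  have hne : (frontier A).Nonempty := by
    have : Nonempty (Fin d) := ⟨⟨0, by omega⟩⟩
    refine nonempty_frontier_iff.2 ⟨hA.isConnected.nonempty, ?_⟩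
    rintro rfl
    exact NormedSpace.unbounded_univ ℝ (EuclideanSpace ℝ (Fin d)) (hΩb.subset hAΩ)
  have hcomp : IsCompact (frontier A) :=
    isCompact_of_isClosed_isBounded isClosed_frontier hA.isBounded_frontier
  choose! ρ hρ δ₁ hδ₁ C hC hloc using fun p hp ↦ hA.exists_local_estimate (Ω := Ω) hAΩ (p := p) hp
  obtain ⟨t, htA, ht⟩ := hcomp.elim_nhds_subcover (fun p ↦ ball p (ρ p / 2))
    fun p hp ↦ ball_mem_nhds p (half_pos (hρ p hp))
  have htne : t.Nonempty := by
    obtain ⟨p, hp⟩ := hne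
    obtain ⟨q, hq, -⟩ := Set.mem_iUnion₂.1 (ht hp)
    exact ⟨q, hq⟩
  refine ⟨∑ p ∈ t, C p, Finset.sum_pos (fun p hp ↦ hC p (htA p hp)) htne,
    t.inf' htne fun p ↦ min (δ₁ p) (ρ p / 2), ?_, fun δ hδ hδ₀ v g hvg ↦ ?_⟩
  · exact (Finset.lt_inf'_iff _).2 fun p hp ↦
      lt_min (hδ₁ p (htA p hp)) (half_pos (hρ p (htA p hp)))
  rw [Finset.lt_inf'_iff] at hδ₀
  obtain ⟨Λ₀, hΩL⟩ := hΩ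
  obtain ⟨V, G, hV, hVm, hG, hGm, hvV, hgG, hw⟩ :=
    hvg.exists_stronglyMeasurable hΩL.isOpen.measurableSet hΩb
  have hUΩ : boundaryLayer A δ ⊆ Ω := fun x hx ↦ hAΩ hx.1
  have hRΩ : innerPart A δ ⊆ Ω := fun x hx ↦ hAΩ hx.1
  set X : ENNReal := ENNReal.ofReal (δ ^ 2) * (∫⁻ x in boundaryLayer A δ, ‖G x‖ₑ ^ 2)
    + ENNReal.ofReal δ * ((∫⁻ x in innerPart A δ, ‖V x‖ₑ ^ 2)
      + ∫⁻ x in innerPart A δ, ‖G x‖ₑ ^ 2)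
  have hnn : ∀ {F : Type} [NormedAddCommGroup F] (S : Set (EuclideanSpace ℝ (Fin d)))
      (u : EuclideanSpace ℝ (Fin d) → F), 0 ≤ l2NormSq S u :=
    fun S u ↦ integral_nonneg fun x ↦ by positivity
  have hnnH : 0 ≤ h1NormSq (innerPart A δ) v g := add_nonneg (hnn _ _) (hnn _ _)
  have hXeq : ENNReal.ofReal (δ ^ 2 * l2NormSq (boundaryLayer A δ) g
      + δ * h1NormSq (innerPart A δ) v g) = X := by
    rw [ENNReal.ofReal_add (mul_nonneg (sq_nonneg _) (hnn _ _)) (mul_nonneg hδ.le hnnH),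
      ENNReal.ofReal_mul (sq_nonneg _), ENNReal.ofReal_mul hδ.le, h1NormSq,
      ENNReal.ofReal_add (hnn _ _) (hnn _ _),
      ofReal_l2NormSq_eq_lintegral hUΩ hvg.memLp_grad hgG,
      ofReal_l2NormSq_eq_lintegral hRΩ hvg.memLp hvV,
      ofReal_l2NormSq_eq_lintegral hRΩ hvg.memLp_grad hgG]
  have hC0 : 0 ≤ ∑ p ∈ t, C p := Finset.sum_nonneg fun p hp ↦ (hC p (htA p hp)).le
  have hcover : boundaryLayer A δ ⊆ ⋃ p : t, boundaryLayer A δ ∩ ball (p : _) (ρ p) := by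
    intro x hx
    obtain ⟨q, hq, hxq⟩ := (infDist_lt_iff hne).1 hx.2
    obtain ⟨p, hp, hqp⟩ := Set.mem_iUnion₂.1 (ht hq)
    refine Set.mem_iUnion.2 ⟨⟨p, hp⟩, hx, ?_⟩
    have h1 : δ < ρ p / 2 := (hδ₀ p hp).trans_le (min_le_right _ _)
    have h2 := dist_triangle x q p
    rw [mem_ball] at hqp ⊢
    linarith
  -- pass to extended nonnegative integrals of the representatives `V` and `G`
  rw [← ENNReal.ofReal_le_ofReal_iff (mul_nonneg hC0 (add_nonneg (mul_nonneg (sq_nonneg _)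
    (hnn _ _)) (mul_nonneg hδ.le hnnH))),
    ENNReal.ofReal_mul hC0, hXeq, ofReal_l2NormSq_eq_lintegral hUΩ hvg.memLp hvV]
  calc ∫⁻ x in boundaryLayer A δ, ‖V x‖ₑ ^ 2
      ≤ ∫⁻ x in ⋃ p : t, boundaryLayer A δ ∩ ball (p : _) (ρ p), ‖V x‖ₑ ^ 2 :=
        lintegral_mono_set hcover
    _ ≤ ∑ p : t, ∫⁻ x in boundaryLayer A δ ∩ ball (p : _) (ρ p), ‖V x‖ₑ ^ 2 := by
        rw [← tsum_fintype (L := .unconditional _)]; exact lintegral_iUnion_le _ _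
    _ ≤ ∑ p : t, ENNReal.ofReal (C p) * X := by
        exact Finset.sum_le_sum fun p _ ↦ hloc p (htA p p.2) δ hδ
          ((hδ₀ p p.2).trans_le (min_le_left _ _)) V G hV hVm hG hGm hw
    _ = ENNReal.ofReal (∑ p ∈ t, C p) * X := by
        rw [← Finset.sum_mul, ENNReal.ofReal_sum_of_nonneg fun p hp ↦ (hC p (htA p hp)).le,
          Finset.sum_coe_sort t fun p ↦ ENNReal.ofReal (C p)]
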